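/- Let $n\ge 4$ and $1\le k<n/2$ be integers, and let $[n]=\{1,\dots,n\}$. Let $B(n,k)$ be the graph whose vertices are the subsets of $[n]$ with exactly $k$ or $k+1$ elements, two vertices being adjacent if and only if one is a proper subset of the other. Let $L(B(n,k))$ be its line graph, whose vertices are the edges of $B(n,k)$, two distinct edges being adjacent if and only if they share an endpoint. If $n\ne 2k+1$, then $$\operatorname{Aut}(L(B(n,k)))\cong \operatorname{Sym}([n]),$$ and if $n=2k+1$, then $$\operatorname{Aut}(L(B(n,k)))\cong \operatorname{Sym}([n])\times\mathbb{Z}_2,$$ where $\cong$ denotes isomorphism of groups, $\operatorname{Sym}([n])$ is the group of all permutations of $[n]$, and $\mathbb{Z}_2$ is the cyclic group of order $2$. -/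

import Mathlib

/-- The graph `B(n,k)`: its vertices are the subsets of `[n]` (modelled by `Fin n`) with `k` or
`k + 1` elements, and two vertices are adjacent when one is a proper subset of the other. -/
def layerGraph (n k : ℕ) :
    SimpleGraph {v : Finset (Fin n) // v.card = k ∨ v.card = k + 1} where
  Adj v w := v.1 ⊂ w.1 ∨ w.1 ⊂ v.1
  symm := ⟨fun _ _ h => h.symm⟩
  loopless := ⟨fun v h => h.elim (ssubset_irrefl v.1) (ssubset_irrefl v.1)⟩

/-- The automorphism group of a simple graph: the adjacency-preserving (in both directions)
permutations of the vertices, with composition as multiplication. -/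
abbrev graphAut {V : Type*} (G : SimpleGraph V) : Type _ := G ≃g G

/-!
The edges of `B(n,k)` are the flags `A ⊂ B` with `|A| = k` and `|B| = k + 1`, and two of them are
adjacent in the line graph exactly when they share `A` or share `B` (`graphIsoLineGraph`). All
flags over one `A` form a clique, as do all flags under one `B`.

An automorphism sends each such clique into a single clique, since pairwise agreement in one of two
coordinates forces a common coordinate (`forall_eq_or_forall_eq`). The two cliques through a flag
must go to cliques of different kinds, and the flags are connected, so the automorphism preserves
the two kinds of clique everywhere or interchanges them everywhere (`preserves_or_swaps`).

If it preserves them, it induces incidence-preserving permutations of the `k`-sets and of the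
`(k + 1)`-sets. The `k`-sets above a fixed `(k - 1)`-set are pairwise contained in a common
`(k + 1)`-set while no three of them lie in the same one. A family with these two properties has a
common `(k - 1)`-subset, so the permutations extend to level `k - 1`, and descending to level `0`
exhibits them as coming from a permutation of `[n]` (`exists_perm_of_incidence`).

If it interchanges them, the `n - k` flags over a `k`-set embed into the `k + 1` flags under a
`(k + 1)`-set, which forces `n = 2k + 1` (`card_le_of_swaps`). In that case complementation is an
interchanging involution commuting with all permutations, and composing with it reduces to the
previous case, giving the extra factor `ℤ/2` (`permComplHom_bijective`).
-/

open scoped Pointwise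

/-! ### Permutations of two consecutive levels -/

section Levels

variable {α : Type*} [DecidableEq α]

lemma eq_insert_erase_of_card_union_le {k : ℕ} {X Y : Finset α} (hX : X.card = k + 1)
    (hY : Y.card = k + 1) (hXY : (Y ∪ X).card ≤ k + 2) {d y : α} (hdX : d ∈ X) (hdY : d ∉ Y)
    (hyY : y ∈ Y) (hyX : y ∉ X) : X = insert d (Y.erase y) := by
  have h1 : (X \ Y).card ≤ 1 := by
    have := Finset.card_union_add_card_inter Y X
    have := Finset.card_sdiff_add_card X Y
    rw [Finset.union_comm] at hXY
    omega
  refine Finset.eq_of_subset_of_card_le (fun z hz => ?_) ?_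
  · by_cases hzY : z ∈ Y
    · grind
    · have := Finset.card_le_one.1 h1 z (Finset.mem_sdiff.2 ⟨hz, hzY⟩) d
        (Finset.mem_sdiff.2 ⟨hdX, hdY⟩)
      grind
  · rw [Finset.card_insert_of_notMem (by grind), Finset.card_erase_of_mem hyY]
    omega

/-- If `Y` is at most one exchange away from both `X` and `Z`, then either `Y` contains `X ∩ Z` or
`Y` is contained in `X ∪ Z`. -/
lemma subset_union_of_card_union_le {k : ℕ} {X Z Y : Finset α} (hX : X.card = k + 1)
    (hZ : Z.card = k + 1) (hY : Y.card = k + 1) (hXZ : X ≠ Z) (hYX : (Y ∪ X).card ≤ k + 2)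
    (hYZ : (Y ∪ Z).card ≤ k + 2) (h : ¬ X ∩ Z ⊆ Y) : Y ⊆ X ∪ Z := by
  obtain ⟨d, hd, hdY⟩ := Finset.not_subset.1 h
  rw [Finset.mem_inter] at hd
  by_contra hn
  obtain ⟨y, hyY, hy⟩ := Finset.not_subset.1 hn
  rw [Finset.mem_union, not_or] at hy
  exact hXZ ((eq_insert_erase_of_card_union_le hX hY hYX hd.1 hdY hyY hy.1).trans
    (eq_insert_erase_of_card_union_le hZ hY hYZ hd.2 hdY hyY hy.2).symm)

variable [Fintype α]

lemma eq_of_superset_imp_superset {k : ℕ} (hk : k + 2 ≤ Fintype.card α) {C D : Finset α}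
    (hC : C.card = k) (hD : D.card = k)
    (h : ∀ A : Finset α, A.card = k + 1 → C ⊆ A → D ⊆ A) : D = C := by
  have hc : 1 < Cᶜ.card := by rw [Finset.card_compl]; omega
  obtain ⟨x, hx, y, hy, hxy⟩ := Finset.one_lt_card.1 hc
  rw [Finset.mem_compl] at hx hy
  have hDx := h (insert x C) (by rw [Finset.card_insert_of_notMem hx, hC])
    (Finset.subset_insert _ _)
  have hDy := h (insert y C) (by rw [Finset.card_insert_of_notMem hy, hC])
    (Finset.subset_insert _ _)
  refine Finset.eq_of_subset_of_card_le (fun z hz => ?_) (by omega)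
  have h1 := hDx hz
  have h2 := hDy hz
  grind

/-- The subsets of `α` with exactly `k` elements. -/
abbrev Level (α : Type*) (k : ℕ) : Type _ := {s : Finset α // s.card = k}

/-- One half of the statement that stars are mapped to stars: the `(k + 1)`-sets above `C` are
mapped to sets above a common `k`-set. -/
lemma exists_subset_of_incidence {k : ℕ} (hk : k + 2 ≤ Fintype.card α)
    (f : Equiv.Perm (Level α (k + 1))) (g : Equiv.Perm (Level α (k + 2)))
    (h : ∀ A B, A.1 ⊆ B.1 ↔ (f A).1 ⊆ (g B).1) (C : Level α k) :
    ∃ D : Level α k, ∀ A, C.1 ⊆ A.1 → D.1 ⊆ (f A).1 := by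
  obtain ⟨C, hC⟩ := C
  have hc : 1 < Cᶜ.card := by rw [Finset.card_compl]; omega
  obtain ⟨x, hx, y, hy, hxy⟩ := Finset.one_lt_card.1 hc
  rw [Finset.mem_compl] at hx hy
  have union_le : ∀ A A' : Level α (k + 1), C ⊆ A.1 → C ⊆ A'.1 → A ≠ A' →
      ∃ B : Level α (k + 2), B.1 = A.1 ∪ A'.1 ∧ (f A).1 ∪ (f A').1 = (g B).1 := by
    intro A A' hA hA' hne
    have hi : A.1 ∩ A'.1 = C := by
      symm
      refine Finset.eq_of_subset_of_card_le (Finset.subset_inter hA hA') ?_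
      by_contra hlt
      have h1 : A.1 ∩ A'.1 = A.1 :=
        Finset.eq_of_subset_of_card_le Finset.inter_subset_left (by rw [A.2]; omega)
      have h2 : A.1 ∩ A'.1 = A'.1 :=
        Finset.eq_of_subset_of_card_le Finset.inter_subset_right (by rw [A'.2]; omega)
      exact hne (Subtype.ext (h1.symm.trans h2))
    have hcard : (A.1 ∪ A'.1).card = k + 2 := by
      have := Finset.card_union_add_card_inter A.1 A'.1
      rw [hi, A.2, A'.2] at this
      omega
    refine ⟨⟨_, hcard⟩, rfl, Finset.eq_of_subset_of_card_le (Finset.union_subset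
      ((h _ _).1 Finset.subset_union_left) ((h _ _).1 Finset.subset_union_right)) ?_⟩
    rw [(g _).2]
    by_contra hlt
    have h1 : (f A).1 = (f A).1 ∪ (f A').1 :=
      Finset.eq_of_subset_of_card_le Finset.subset_union_left (by rw [(f A).2]; omega)
    have h2 : (f A').1 = (f A).1 ∪ (f A').1 :=
      Finset.eq_of_subset_of_card_le Finset.subset_union_right (by rw [(f A').2]; omega)
    exact hne (f.injective (Subtype.ext (h1.trans h2.symm)))
  let X : Level α (k + 1) := ⟨insert x C, by rw [Finset.card_insert_of_notMem hx, hC]⟩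
  let Z : Level α (k + 1) := ⟨insert y C, by rw [Finset.card_insert_of_notMem hy, hC]⟩
  have hCX : C ⊆ X.1 := Finset.subset_insert _ _
  have hCZ : C ⊆ Z.1 := Finset.subset_insert _ _
  have hXZ : X ≠ Z := by
    intro he
    have hval : insert x C = insert y C := Subtype.ext_iff.1 he
    have : x ∈ insert y C := hval ▸ Finset.mem_insert_self x C
    grind
  have hne : (f X).1 ≠ (f Z).1 := fun he => hXZ (f.injective (Subtype.ext he))
  obtain ⟨B, hB, hgB⟩ := union_le X Z hCX hCZ hXZ
  refine ⟨⟨(f X).1 ∩ (f Z).1, ?_⟩, fun A hA => ?_⟩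
  · have := Finset.card_union_add_card_inter (f X).1 (f Z).1
    rw [hgB, (g B).2, (f X).2, (f Z).2] at this
    omega
  · by_cases hAX : A = X
    · rw [hAX]; exact Finset.inter_subset_left
    by_cases hAZ : A = Z
    · rw [hAZ]; exact Finset.inter_subset_right
    by_contra hn
    obtain ⟨B₁, -, h₁⟩ := union_le A X hA hCX hAX
    obtain ⟨B₂, -, h₂⟩ := union_le A Z hA hCZ hAZ
    have hsub := subset_union_of_card_union_le (f X).2 (f Z).2 (f A).2 hne
      (by rw [h₁, (g B₁).2]) (by rw [h₂, (g B₂).2]) hn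
    rw [hgB, ← h, hB] at hsub
    -- A `(k + 1)`-set between `C` and `C ∪ {x, y}` is one of the two chosen ones.
    obtain ⟨a, haC, ha⟩ := Finset.exists_eq_insert_iff.2 ⟨hA, by rw [hC, A.2]⟩
    have : a ∈ insert x C ∪ insert y C := hsub (ha ▸ Finset.mem_insert_self a C)
    have : a = x ∨ a = y := by grind
    rcases this with rfl | rfl
    · exact hAX (Subtype.ext ha.symm)
    · exact hAZ (Subtype.ext ha.symm)

/-- An incidence-preserving pair of permutations of levels `k + 1` and `k + 2` extends to
level `k`. -/
lemma exists_perm_level_of_incidence {k : ℕ} (hk : k + 2 ≤ Fintype.card α)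
    (f : Equiv.Perm (Level α (k + 1))) (g : Equiv.Perm (Level α (k + 2)))
    (h : ∀ A B, A.1 ⊆ B.1 ↔ (f A).1 ⊆ (g B).1) :
    ∃ e : Equiv.Perm (Level α k), ∀ C A, C.1 ⊆ A.1 ↔ (e C).1 ⊆ (f A).1 := by
  have hinv : ∀ A B, A.1 ⊆ B.1 ↔ (f.symm A).1 ⊆ (g.symm B).1 := fun A B => by
    rw [h (f.symm A), f.apply_symm_apply, g.apply_symm_apply]
  choose e he using exists_subset_of_incidence hk f g h
  choose e' he' using exists_subset_of_incidence hk f.symm g.symm hinv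
  have hee : ∀ C, e' (e C) = C := fun C => Subtype.ext <|
    eq_of_superset_imp_superset hk C.2 (e' (e C)).2 fun A hA hCA => by
      simpa using he' (e C) (f ⟨A, hA⟩) (he C ⟨A, hA⟩ hCA)
  have hbij : Function.Bijective e :=
    Finite.injective_iff_bijective.1 (Function.LeftInverse.injective hee)
  refine ⟨Equiv.ofBijective e hbij, fun C A => ⟨he C A, fun hCA => ?_⟩⟩
  have := he' (e C) (f A) hCA
  rwa [hee, f.symm_apply_apply] at this

/-- An incidence-preserving pair of permutations of two consecutive levels of the Boolean lattice
is induced by a permutation of the ground set. -/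
theorem exists_perm_of_incidence {k : ℕ} (hk : k + 2 ≤ Fintype.card α ∨ k = 0)
    (f : Equiv.Perm (Level α k)) (g : Equiv.Perm (Level α (k + 1)))
    (h : ∀ A B, A.1 ⊆ B.1 ↔ (f A).1 ⊆ (g B).1) :
    ∃ σ : Equiv.Perm α, (∀ A, (f A).1 = σ • A.1) ∧ ∀ B, (g B).1 = σ • B.1 := by
  induction k with
  | zero =>
    have hs : ∀ x : α, ∃ y, (g ⟨{x}, Finset.card_singleton x⟩).1 = {y} := fun x =>
      Finset.card_eq_one.1 (g _).2
    choose s hs using hs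
    have hinj : Function.Injective s := fun x y hxy => by
      have := g.injective (Subtype.ext ((hs x).trans (hxy ▸ (hs y).symm)))
      simpa using this
    refine ⟨Equiv.ofBijective s (Finite.injective_iff_bijective.1 hinj), fun A => ?_, ?_⟩
    · rw [Finset.card_eq_zero.1 A.2, Finset.card_eq_zero.1 (f A).2, Finset.smul_finset_empty]
    · rintro ⟨B, hB⟩
      obtain ⟨x, rfl⟩ := Finset.card_eq_one.1 hB
      rw [hs, Finset.smul_finset_singleton]
      rfl
  | succ k ih =>
    have hk' : k + 3 ≤ Fintype.card α := by omega
    obtain ⟨e, he⟩ := exists_perm_level_of_incidence (by omega) f g h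
    obtain ⟨σ, -, hσ⟩ := ih (Or.inl (by omega)) e f he
    refine ⟨σ, hσ, fun B => ?_⟩
    symm
    refine Finset.eq_of_subset_of_card_le (fun z hz => ?_) (by
      rw [Finset.card_smul_finset, B.2, (g B).2])
    -- A point of `B` lies in some `(k + 1)`-subset of `B`, on which the image is known.
    obtain ⟨x, hx, rfl⟩ := Finset.mem_smul_finset.1 hz
    obtain ⟨A, hxA, hAB, hA⟩ := Finset.exists_subsuperset_card_eq
      (Finset.singleton_subset_iff.2 hx) (n := k + 1) (by simp) (by rw [B.2]; omega)
    have := (h ⟨A, hA⟩ B).1 hAB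
    rw [hσ] at this
    exact this (Finset.smul_mem_smul_finset (hxA (Finset.mem_singleton_self x)))

end Levels

/-! ### Agreement in one of two coordinates -/

/-- A set of points of a grid, any two of which lie on a common row or a common column, lies on a
single row or a single column; here the points are the pairs `(a f, b f)` for `f` in a fibre
of `l`. -/
lemma forall_eq_or_forall_eq {E X Y Z : Type*} {l : E → X} {a : E → Y} {b : E → Z}
    (h : ∀ e f, l e = l f → a e = a f ∨ b e = b f) (e : E) :
    (∀ f g, l f = l e → l g = l e → a f = a g) ∨
      (∀ f g, l f = l e → l g = l e → b f = b g) := by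
  by_contra! hn
  obtain ⟨⟨f, g, hf, hg, hfg⟩, f', g', hf', hg', hfg'⟩ := hn
  have h1 := h f f' (hf.trans hf'.symm)
  have h2 := h f g' (hf.trans hg'.symm)
  have h3 := h g f' (hg.trans hf'.symm)
  have h4 := h g g' (hg.trans hg'.symm)
  have h5 := h f g (hf.trans hg.symm)
  have h6 := h f' g' (hf'.trans hg'.symm)
  grind

/-! ### Flags -/

/-- The edges of `layerGraph`, encoded as pairs of a `k`-set and a `(k + 1)`-set containing it. -/
@[ext]
structure LayerFlag (α : Type*) (k : ℕ) where
  /-- The smaller set of the flag. -/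
  lower : Level α k
  /-- The larger set of the flag. -/
  upper : Level α (k + 1)
  sub : lower.1 ⊆ upper.1

namespace LayerFlag

variable {α : Type*} {k : ℕ}

/-- The line graph of `layerGraph` in terms of flags: distinct flags are adjacent when they share
their smaller or their larger set. -/
def graph (α : Type*) (k : ℕ) : SimpleGraph (LayerFlag α k) where
  Adj e f := e ≠ f ∧ (e.lower = f.lower ∨ e.upper = f.upper)
  symm := ⟨fun _ _ h => ⟨h.1.symm, h.2.imp Eq.symm Eq.symm⟩⟩
  loopless := ⟨fun _ h => h.1 rfl⟩

lemma aut_apply_adj_iff (φ : graph α k ≃g graph α k) (e f : LayerFlag α k) :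
    ((φ e).lower = (φ f).lower ∨ (φ e).upper = (φ f).upper) ↔
      (e.lower = f.lower ∨ e.upper = f.upper) := by
  by_cases h : e = f
  · simp [h]
  · have := φ.map_rel_iff (a := e) (b := f)
    have hφ : φ e ≠ φ f := φ.injective.ne h
    exact (and_iff_right hφ).symm.trans (this.trans (and_iff_right h))

section

variable [DecidableEq α]

/-- The flag consisting of `A` and `A ∪ {x}`. -/
def ofInsert (A : Level α k) (x : α) (hx : x ∉ A.1) : LayerFlag α k where
  lower := A
  upper := ⟨insert x A.1, by rw [Finset.card_insert_of_notMem hx, A.2]⟩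
  sub := Finset.subset_insert _ _

/-- The flag consisting of `B \ {x}` and `B`. -/
def ofErase (B : Level α (k + 1)) (x : α) (hx : x ∈ B.1) : LayerFlag α k where
  lower := ⟨B.1.erase x, by rw [Finset.card_erase_of_mem hx, B.2]; omega⟩
  upper := B
  sub := Finset.erase_subset _ _

/-- Permutations of the ground set act on flags by taking images of both sets. -/
instance : MulAction (Equiv.Perm α) (LayerFlag α k) where
  smul σ e :=
    { lower := ⟨σ • e.lower.1, by rw [Finset.card_smul_finset, e.lower.2]⟩
      upper := ⟨σ • e.upper.1, by rw [Finset.card_smul_finset, e.upper.2]⟩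
      sub := Finset.smul_finset_subset_smul_finset e.sub }
  one_smul e := LayerFlag.ext (Subtype.ext (one_smul _ e.lower.1))
    (Subtype.ext (one_smul _ e.upper.1))
  mul_smul σ τ e := LayerFlag.ext (Subtype.ext (mul_smul σ τ e.lower.1))
    (Subtype.ext (mul_smul σ τ e.upper.1))

@[simp]
lemma lower_smul (σ : Equiv.Perm α) (e : LayerFlag α k) : (σ • e).lower.1 = σ • e.lower.1 := rfl

@[simp]
lemma upper_smul (σ : Equiv.Perm α) (e : LayerFlag α k) : (σ • e).upper.1 = σ • e.upper.1 := rfl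

/-- The action of permutations of the ground set on flags, as graph automorphisms. -/
def permHom (α : Type*) [DecidableEq α] (k : ℕ) : Equiv.Perm α →* graphAut (graph α k) where
  toFun σ :=
    { toEquiv := MulAction.toPerm (β := LayerFlag α k) σ
      map_rel_iff' := by
        intro e f
        simp [graph, LayerFlag.ext_iff, Subtype.ext_iff] }
  map_one' := by ext1 e; exact one_smul (Equiv.Perm α) e
  map_mul' σ τ := by ext1 e; exact mul_smul σ τ e

@[simp]
lemma permHom_apply (σ : Equiv.Perm α) (e : LayerFlag α k) : permHom α k σ e = σ • e := rfl

lemma exists_upper_eq (B : Level α (k + 1)) : ∃ e : LayerFlag α k, e.upper = B := by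
  obtain ⟨x, hx⟩ := Finset.card_pos.1 (by rw [B.2]; omega : 0 < B.1.card)
  exact ⟨ofErase B x hx, rfl⟩

lemma exists_ne_upper_eq (hk : 1 ≤ k) (e : LayerFlag α k) :
    ∃ f, f ≠ e ∧ f.upper = e.upper := by
  obtain ⟨x, hx⟩ := Finset.card_pos.1 (by rw [e.lower.2]; omega : 0 < e.lower.1.card)
  refine ⟨ofErase e.upper x (e.sub hx), fun he => ?_, rfl⟩
  rw [← he] at hx
  exact Finset.notMem_erase _ _ hx

/-- The flag graph is connected, as an induction principle. -/
lemma forall_of_adj {T : LayerFlag α k → Prop}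
    (hl : ∀ e f, e.lower = f.lower → T e → T f) (hu : ∀ e f, e.upper = f.upper → T e → T f)
    {e : LayerFlag α k} (he : T e) (f : LayerFlag α k) : T f := by
  induction hm : (e.lower.1 \ f.lower.1).card using Nat.strong_induction_on generalizing e with
  | _ m ih =>
    rcases Finset.eq_empty_or_nonempty (e.lower.1 \ f.lower.1) with h0 | ⟨x, hx⟩
    · rw [Finset.sdiff_eq_empty_iff_subset] at h0
      exact hl e f (Subtype.ext (Finset.eq_of_subset_of_card_le h0
        (by rw [e.lower.2, f.lower.2]))) he
    · have hpos : 0 < (f.lower.1 \ e.lower.1).card := by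
        rw [Finset.card_sdiff_comm (f.lower.2.trans e.lower.2.symm)]
        exact Finset.card_pos.2 ⟨x, hx⟩
      obtain ⟨y, hy⟩ := Finset.card_pos.1 hpos
      rw [Finset.mem_sdiff] at hx hy
      -- Exchange `x` for `y` in the smaller set, passing through a common larger set.
      have he₁ : T (ofInsert e.lower y hy.2) := hl e _ rfl he
      have hxm : x ∈ (ofInsert e.lower y hy.2).upper.1 := Finset.mem_insert_of_mem hx.1
      have he₂ : T (ofErase _ x hxm) := hu (ofInsert e.lower y hy.2) _ rfl he₁
      refine ih _ ?_ he₂ rfl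
      rw [← hm]
      refine Finset.card_lt_card ((Finset.ssubset_iff_of_subset fun z hz => ?_).2
        ⟨x, Finset.mem_sdiff.2 hx, ?_⟩)
      · simp only [ofErase, ofInsert, Finset.mem_sdiff, Finset.mem_erase, Finset.mem_insert]
          at hz ⊢
        grind
      · simp [ofErase]

variable [Fintype α]

lemma exists_lower_eq (hk : k < Fintype.card α) (A : Level α k) :
    ∃ e : LayerFlag α k, e.lower = A := by
  obtain ⟨x, hx⟩ : ∃ x, x ∉ A.1 := by
    by_contra! h
    have := A.2
    rw [Finset.eq_univ_iff_forall.2 h, Finset.card_univ] at this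
    omega
  exact ⟨ofInsert A x hx, rfl⟩

lemma exists_ne_lower_eq (hk : k + 2 ≤ Fintype.card α) (e : LayerFlag α k) :
    ∃ f, f ≠ e ∧ f.lower = e.lower := by
  have hc : 0 < e.upper.1ᶜ.card := by rw [Finset.card_compl, e.upper.2]; omega
  obtain ⟨x, hx⟩ := Finset.card_pos.1 hc
  rw [Finset.mem_compl] at hx
  refine ⟨ofInsert e.lower x fun h => hx (e.sub h), fun he => hx ?_, rfl⟩
  rw [← he]
  exact Finset.mem_insert_self _ _

/-! ### Automorphisms respecting both kinds of adjacency -/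

/-- An automorphism that respects sharing the smaller set and sharing the larger set comes from a
permutation of the ground set. -/
lemma exists_permHom_eq (hk : k + 2 ≤ Fintype.card α) (φ : graph α k ≃g graph α k)
    (hl : ∀ e f, e.lower = f.lower → (φ e).lower = (φ f).lower)
    (hu : ∀ e f, e.upper = f.upper → (φ e).upper = (φ f).upper) :
    ∃ σ, permHom α k σ = φ := by
  choose a ha using exists_lower_eq (α := α) (k := k) (by omega)
  choose b hb using exists_upper_eq (α := α) (k := k)
  have hl' : ∀ e f, (φ e).lower = (φ f).lower → e.lower = f.lower := fun e f h => by
    rcases (aut_apply_adj_iff φ e f).1 (Or.inl h) with h' | h'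
    · exact h'
    · rw [φ.injective (LayerFlag.ext h (hu e f h'))]
  have hu' : ∀ e f, (φ e).upper = (φ f).upper → e.upper = f.upper := fun e f h => by
    rcases (aut_apply_adj_iff φ e f).1 (Or.inr h) with h' | h'
    · rw [φ.injective (LayerFlag.ext (hl e f h') h)]
    · exact h'
  have hf : Function.Injective fun A => (φ (a A)).lower := fun A A' h => by
    rw [← ha A, ← ha A', hl' _ _ h]
  have hg : Function.Injective fun B => (φ (b B)).upper := fun B B' h => by
    rw [← hb B, ← hb B', hu' _ _ h]
  have hfe : ∀ e, (φ (a e.lower)).lower = (φ e).lower := fun e => hl _ _ (ha _)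
  have hge : ∀ e, (φ (b e.upper)).upper = (φ e).upper := fun e => hu _ _ (hb _)
  obtain ⟨σ, hσ, hσ'⟩ := exists_perm_of_incidence (Or.inl hk)
    (Equiv.ofBijective _ (Finite.injective_iff_bijective.1 hf))
    (Equiv.ofBijective _ (Finite.injective_iff_bijective.1 hg)) (fun A B => by
      simp only [Equiv.ofBijective_apply]
      refine ⟨fun h => ?_, fun h => ?_⟩
      · rw [hfe ⟨A, B, h⟩, hge ⟨A, B, h⟩]
        exact (φ _).sub
      · obtain ⟨e, he⟩ := φ.surjective ⟨_, _, h⟩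
        have h1 := hl' e (a A) (by rw [he])
        have h2 := hu' e (b B) (by rw [he])
        rw [← ha A, ← hb B, ← h1, ← h2]
        exact e.sub)
  simp only [Equiv.ofBijective_apply] at hσ hσ'
  refine ⟨σ, RelIso.ext fun e => LayerFlag.ext (Subtype.ext ?_) (Subtype.ext ?_)⟩
  · rw [permHom_apply, lower_smul, ← hσ, hfe]
  · rw [permHom_apply, upper_smul, ← hσ', hge]

/-! ### Preserving or interchanging the kinds of adjacency -/

/-- An automorphism of the flag graph either respects sharing the smaller set and sharing the
larger set, or interchanges the two everywhere. -/
lemma preserves_or_swaps (hk : 1 ≤ k) (hk' : k + 2 ≤ Fintype.card α)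
    (φ : graph α k ≃g graph α k) :
    ((∀ e f, e.lower = f.lower → (φ e).lower = (φ f).lower) ∧
      ∀ e f, e.upper = f.upper → (φ e).upper = (φ f).upper) ∨
    ((∀ e f, e.lower = f.lower → (φ e).upper = (φ f).upper) ∧
      ∀ e f, e.upper = f.upper → (φ e).lower = (φ f).lower) := by
  have hlow := forall_eq_or_forall_eq (l := LayerFlag.lower (α := α) (k := k)) 
    (a := fun e => (φ e).lower) (b := fun e => (φ e).upper) fun e f h => (aut_apply_adj_iff φ e f).2 (Or.inl h)
  have hup := forall_eq_or_forall_eq (l := LayerFlag.upper (α := α) (k := k)) 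
    (a := fun e => (φ e).upper) (b := fun e => (φ e).lower) fun e f h => ((aut_apply_adj_iff φ e f).2 (Or.inr h)).symm
  -- The two stars through a flag cannot be mapped into the same star: they contain flags that
  -- are neither equal nor adjacent.
  have key : ∀ e : LayerFlag α k, ∃ f g : LayerFlag α k, f.lower = e.lower ∧ g.upper = e.upper ∧
      (φ f).lower ≠ (φ g).lower ∧ (φ f).upper ≠ (φ g).upper := fun e => by
    obtain ⟨f, hf, hfe⟩ := exists_ne_lower_eq hk' e
    obtain ⟨g, hg, hge⟩ := exists_ne_upper_eq hk e
    refine ⟨f, g, hfe, hge, ?_⟩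
    rw [← not_or, aut_apply_adj_iff, hfe, hge, not_or]
    exact ⟨fun h => hg (LayerFlag.ext h.symm hge), fun h => hf (LayerFlag.ext hfe h)⟩
  let T : LayerFlag α k → Prop := fun e =>
    ∀ f g, f.lower = e.lower → g.lower = e.lower → (φ f).lower = (φ g).lower
  have hT : ∀ e, T e ↔
      ∀ f g, f.upper = e.upper → g.upper = e.upper → (φ f).upper = (φ g).upper := fun e => by
    obtain ⟨f, g, hf, hg, hl, hu⟩ := key e
    refine ⟨fun h => (hup e).resolve_right fun h' => hl ?_,
      fun h => (hlow e).resolve_right fun h' => hu ?_⟩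
    · exact (h f e hf rfl).trans (h' e g rfl hg)
    · exact (h' f e hf rfl).trans (h e g rfl hg)
  have hTl : ∀ e f, e.lower = f.lower → T e → T f := fun e f hef h => by
    simpa only [T, hef] using h
  have hTu : ∀ e f, e.upper = f.upper → T e → T f := fun e f hef h => by
    rw [hT] at h ⊢
    simpa only [hef] using h
  by_cases hex : ∃ e, T e
  · obtain ⟨e, he⟩ := hex
    have hall := forall_of_adj hTl hTu he
    exact Or.inl ⟨fun f g h => hall f f g rfl h.symm, fun f g h => (hT f).1 (hall f) f g rfl h.symm⟩
  · push Not at hex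
    exact Or.inr ⟨fun f g h => (hlow f).resolve_left (hex f) f g rfl h.symm,
      fun f g h => (hup f).resolve_left (fun h' => hex f ((hT f).2 h')) f g rfl h.symm⟩

/-- Interchanging would embed the `n - k` flags over a `k`-set into the `k + 1` flags below a
`(k + 1)`-set. -/
lemma card_le_of_swaps (φ : graph α k ≃g graph α k)
    (h : ∀ e f, e.lower = f.lower → (φ e).upper = (φ f).upper) (e : LayerFlag α k) :
    Fintype.card α ≤ 2 * k + 1 := by
  have hlow : ∀ e f, e.lower = f.lower → (φ e).lower = (φ f).lower → e = f :=
    fun e f h1 h2 => φ.injective (LayerFlag.ext h2 (h e f h1))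
  have hcard : (e.lower.1ᶜ).attach.card ≤ (Finset.powersetCard k (φ e).upper.1).card := by
    refine Finset.card_le_card_of_injOn
      (fun x => (φ (ofInsert e.lower x.1 (Finset.mem_compl.1 x.2))).lower.1) ?_ ?_
    · intro x _
      rw [Finset.mem_coe, Finset.mem_powersetCard]
      refine ⟨?_, (φ _).lower.2⟩
      rw [h e (ofInsert e.lower x.1 (Finset.mem_compl.1 x.2)) rfl]
      exact (φ _).sub
    · intro x _ y _ hxy
      have hf := hlow (ofInsert e.lower x.1 (Finset.mem_compl.1 x.2))
        (ofInsert e.lower y.1 (Finset.mem_compl.1 y.2)) rfl (Subtype.ext hxy)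
      have hmem : x.1 ∈ insert y.1 e.lower.1 := by
        have : insert x.1 e.lower.1 = insert y.1 e.lower.1 :=
          congrArg (fun e : LayerFlag α k => e.upper.1) hf
        rw [← this]
        exact Finset.mem_insert_self _ _
      exact Subtype.ext ((Finset.mem_insert.1 hmem).resolve_right (Finset.mem_compl.1 x.2))
  rw [Finset.card_attach, Finset.card_compl, Finset.card_powersetCard, e.lower.2,
    (φ e).upper.2, Nat.choose_succ_self_right] at hcard
  omega

/-! ### Complementation and the automorphism group of the flag graph -/

/-- Passing to complements in the middle levels, where it interchanges `lower` and `upper`. -/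
def complIso (hα : Fintype.card α = 2 * k + 1) : graph α k ≃g graph α k where
  toFun e :=
    { lower := ⟨e.upper.1ᶜ, by rw [Finset.card_compl, e.upper.2]; omega⟩
      upper := ⟨e.lower.1ᶜ, by rw [Finset.card_compl, e.lower.2]; omega⟩
      sub := Finset.compl_subset_compl.2 e.sub }
  invFun e :=
    { lower := ⟨e.upper.1ᶜ, by rw [Finset.card_compl, e.upper.2]; omega⟩
      upper := ⟨e.lower.1ᶜ, by rw [Finset.card_compl, e.lower.2]; omega⟩
      sub := Finset.compl_subset_compl.2 e.sub }
  left_inv e := by simp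
  right_inv e := by simp
  map_rel_iff' := by
    intro e f
    simp [graph, LayerFlag.ext_iff, Subtype.ext_iff]
    tauto

@[simp]
lemma lower_complIso (hα : Fintype.card α = 2 * k + 1) (e : LayerFlag α k) :
    (complIso hα e).lower.1 = e.upper.1ᶜ := rfl

@[simp]
lemma upper_complIso (hα : Fintype.card α = 2 * k + 1) (e : LayerFlag α k) :
    (complIso hα e).upper.1 = e.lower.1ᶜ := rfl

lemma perm_smul_compl (σ : Equiv.Perm α) (s : Finset α) : σ • sᶜ = (σ • s)ᶜ := by
  ext x
  simp [← Finset.inv_smul_mem_iff]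

lemma complIso_mul_self (hα : Fintype.card α = 2 * k + 1) :
    (complIso hα : graphAut (graph α k)) * complIso hα = 1 :=
  RelIso.ext (complIso hα).left_inv

lemma commute_permHom_complIso (hα : Fintype.card α = 2 * k + 1) (σ : Equiv.Perm α) :
    Commute (permHom α k σ) (complIso hα) := by
  refine RelIso.ext fun e => LayerFlag.ext (Subtype.ext ?_) (Subtype.ext ?_)
  · change σ • e.upper.1ᶜ = (σ • e.upper.1)ᶜ
    exact perm_smul_compl _ _
  · change σ • e.lower.1ᶜ = (σ • e.lower.1)ᶜ
    exact perm_smul_compl _ _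

lemma permHom_injective (hk : 1 ≤ k) (hk' : k < Fintype.card α) :
    Function.Injective (permHom α k) := by
  rw [injective_iff_map_eq_one]
  intro σ hσ
  ext x
  by_contra hx
  rw [Equiv.Perm.one_apply] at hx
  -- A `k`-set containing `x` but not `σ x` is moved.
  obtain ⟨A, hxA, hAx, hA⟩ := Finset.exists_subsuperset_card_eq (n := k)
    (s := {x}) (t := {σ x}ᶜ) (by simpa using hx) (by simpa)
    (by rw [Finset.card_compl, Finset.card_singleton]; omega)
  obtain ⟨e, he⟩ := exists_lower_eq hk' ⟨A, hA⟩
  have h1 : σ • e.lower.1 = e.lower.1 :=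
    congrArg (fun φ : graphAut (graph α k) => (φ e).lower.1) hσ
  rw [he] at h1
  have h2 : σ x ∈ σ • A := Finset.smul_mem_smul_finset (hxA (Finset.mem_singleton_self x))
  rw [h1] at h2
  simpa using hAx h2

lemma permHom_bijective (hk : 1 ≤ k) (hk' : 2 * k + 1 < Fintype.card α) :
    Function.Bijective (permHom α k) := by
  refine ⟨permHom_injective hk (by omega), fun φ => ?_⟩
  rcases preserves_or_swaps hk (by omega) φ with ⟨hl, hu⟩ | ⟨hl, -⟩
  · exact exists_permHom_eq (by omega) φ hl hu
  · obtain ⟨A, -, hA⟩ := Finset.exists_subset_card_eq (s := (Finset.univ : Finset α)) (n := k)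
      (by rw [Finset.card_univ]; omega)
    obtain ⟨e, -⟩ := exists_lower_eq (by omega) ⟨A, hA⟩
    have := card_le_of_swaps φ hl e
    omega

/-- The homomorphism from `ℤ/2` sending the generator to complementation. -/
def complHom (hα : Fintype.card α = 2 * k + 1) :
    Multiplicative (ZMod 2) →* graphAut (graph α k) where
  toFun ε := if ε = 1 then 1 else complIso hα
  map_one' := rfl
  map_mul' ε δ := by
    have h : ∀ ε : Multiplicative (ZMod 2), ε = 1 ∨ ε = Multiplicative.ofAdd 1 := by decide
    have h1 : Multiplicative.ofAdd (1 : ZMod 2) ≠ 1 := by decide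
    have h2 : Multiplicative.ofAdd (1 : ZMod 2) * Multiplicative.ofAdd 1 = 1 := by decide
    rcases h ε with rfl | rfl <;> rcases h δ with rfl | rfl <;>
      simp [h1, h2, complIso_mul_self]

/-- The action on the middle levels of permutations of the ground set together with
complementation. -/
def permComplHom (hα : Fintype.card α = 2 * k + 1) :
    Equiv.Perm α × Multiplicative (ZMod 2) →* graphAut (graph α k) :=
  (permHom α k).noncommCoprod (complHom hα) fun σ ε => by
    change Commute _ (if ε = 1 then 1 else _)
    split_ifs
    · exact Commute.one_right _
    · exact commute_permHom_complIso hα σ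

lemma permComplHom_bijective (hk : 1 ≤ k) (hα : Fintype.card α = 2 * k + 1) :
    Function.Bijective (permComplHom (α := α) hα) := by
  have happ : ∀ σ ε, permComplHom hα (σ, ε) = permHom α k σ * complHom hα ε := fun _ _ => rfl
  have hcompl : ∀ ε, ε ≠ 1 → complHom (α := α) hα ε = complIso hα := fun _ h => if_neg h
  refine ⟨(injective_iff_map_eq_one _).2 ?_, fun φ => ?_⟩
  · rintro ⟨σ, ε⟩ h
    rw [happ] at h
    by_cases hε : ε = 1
    · rw [hε, map_one, mul_one] at h
      rw [hε, permHom_injective hk (by omega) (h.trans (map_one _).symm)]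
      rfl
    · exfalso
      -- The product interchanges the two kinds of adjacency, unlike the identity.
      rw [hcompl ε hε] at h
      have hφ : ∀ e : LayerFlag α k, σ • complIso hα e = e := fun e =>
        congrArg (fun φ : graphAut (graph α k) => φ e) h
      obtain ⟨A, -, hA⟩ := Finset.exists_subset_card_eq (s := (Finset.univ : Finset α)) (n := k)
        (by rw [Finset.card_univ]; omega)
      obtain ⟨e, -⟩ := exists_lower_eq (by omega) ⟨A, hA⟩
      obtain ⟨f, hfe, hf⟩ := exists_ne_lower_eq (by omega) e
      refine hfe (LayerFlag.ext hf (Subtype.ext ?_))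
      rw [← hφ f, ← hφ e, upper_smul, upper_smul, upper_complIso, upper_complIso, hf]
  · rcases preserves_or_swaps hk (by omega) φ with ⟨hl, hu⟩ | ⟨hl, hu⟩
    · obtain ⟨σ, hσ⟩ := exists_permHom_eq (by omega) φ hl hu
      exact ⟨(σ, 1), by rw [happ, map_one, mul_one, hσ]⟩
    · -- Composing with complementation reduces to the previous case.
      obtain ⟨σ, hσ⟩ := exists_permHom_eq (by omega) ((complIso hα).trans φ)
        (fun e f h => hu _ _ (Subtype.ext (by simp [h])))
        (fun e f h => hl _ _ (Subtype.ext (by simp [h])))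
      have hσ' : permHom α k σ = (φ : graphAut (graph α k)) * complIso hα := hσ
      refine ⟨(σ, Multiplicative.ofAdd 1), ?_⟩
      rw [happ, hcompl _ (by decide), hσ', mul_assoc, complIso_mul_self, mul_one]

end

/-! ### Comparison with the line graph -/

lemma lower_ne_upper {n : ℕ} (e f : LayerFlag (Fin n) k) : e.lower.1 ≠ f.upper.1 := fun h => by
  have := congrArg Finset.card h
  rw [e.lower.2, f.upper.2] at this
  omega

/-- The edge of `layerGraph` given by a flag. -/
def toEdge {n : ℕ} (e : LayerFlag (Fin n) k) : (layerGraph n k).edgeSet :=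
  ⟨s(⟨e.lower.1, Or.inl e.lower.2⟩, ⟨e.upper.1, Or.inr e.upper.2⟩),
    Or.inl (Finset.ssubset_iff_subset_ne.2 ⟨e.sub, lower_ne_upper e e⟩)⟩

lemma mem_toEdge {n : ℕ} {e : LayerFlag (Fin n) k}
    {v : {v : Finset (Fin n) // v.card = k ∨ v.card = k + 1}} :
    v ∈ (toEdge e).1 ↔ v.1 = e.lower.1 ∨ v.1 = e.upper.1 := by
  simp [toEdge, Subtype.ext_iff]

lemma exists_mem_toEdge_iff {n : ℕ} (e f : LayerFlag (Fin n) k) :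
    (∃ v, v ∈ (toEdge e).1 ∧ v ∈ (toEdge f).1) ↔ e.lower = f.lower ∨ e.upper = f.upper := by
  simp only [mem_toEdge]
  constructor
  · rintro ⟨v, h1 | h1, h2 | h2⟩
    · exact Or.inl (Subtype.ext (h1.symm.trans h2))
    · exact (lower_ne_upper _ _ (h1.symm.trans h2)).elim
    · exact (lower_ne_upper _ _ (h2.symm.trans h1)).elim
    · exact Or.inr (Subtype.ext (h1.symm.trans h2))
  · rintro (h | h)
    · exact ⟨⟨e.lower.1, Or.inl e.lower.2⟩, Or.inl rfl, Or.inl (by rw [h])⟩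
    · exact ⟨⟨e.upper.1, Or.inr e.upper.2⟩, Or.inr rfl, Or.inr (by rw [h])⟩

lemma toEdge_bijective {n : ℕ} : Function.Bijective (toEdge (n := n) (k := k)) := by
  constructor
  · intro e f h
    have hl : (⟨e.lower.1, Or.inl e.lower.2⟩ :
        {v : Finset (Fin n) // v.card = k ∨ v.card = k + 1}) ∈ (toEdge f).1 :=
      h ▸ mem_toEdge.2 (Or.inl rfl)
    have hu : (⟨e.upper.1, Or.inr e.upper.2⟩ :
        {v : Finset (Fin n) // v.card = k ∨ v.card = k + 1}) ∈ (toEdge f).1 :=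
      h ▸ mem_toEdge.2 (Or.inr rfl)
    rw [mem_toEdge] at hl hu
    exact LayerFlag.ext (Subtype.ext (hl.resolve_right (lower_ne_upper e f)))
      (Subtype.ext (hu.resolve_left (lower_ne_upper f e).symm))
  · have key : ∀ v w : {v : Finset (Fin n) // v.card = k ∨ v.card = k + 1}, v.1 ⊂ w.1 →
        ∃ e, (toEdge e).1 = s(v, w) := fun v w h => by
      have hlt := Finset.card_lt_card h
      have hv : v.1.card = k := by
        have := v.2; have := w.2; omega
      have hw : w.1.card = k + 1 := by
        have := v.2; have := w.2; omega
      exact ⟨⟨⟨v.1, hv⟩, ⟨w.1, hw⟩, h.1⟩, rfl⟩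
    rintro ⟨p, hp⟩
    induction p using Sym2.ind with
    | _ v w =>
      rcases hp with h | h
      · obtain ⟨e, he⟩ := key v w h
        exact ⟨e, Subtype.ext he⟩
      · obtain ⟨e, he⟩ := key w v h
        exact ⟨e, Subtype.ext (he.trans Sym2.eq_swap)⟩

/-- The flag graph is isomorphic to the line graph of `layerGraph`, by sending each flag to its
edge. -/
noncomputable def graphIsoLineGraph (n k : ℕ) :
    graph (Fin n) k ≃g (layerGraph n k).lineGraph where
  toEquiv := Equiv.ofBijective toEdge toEdge_bijective
  map_rel_iff' := by
    intro e f
    rw [SimpleGraph.lineGraph_adj_iff_exists, Equiv.ofBijective_apply, Equiv.ofBijective_apply,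
      exists_mem_toEdge_iff, toEdge_bijective.1.ne_iff]
    rfl

end LayerFlag

/-- Isomorphic graphs have isomorphic automorphism groups, by conjugation. -/
def graphAutCongr {V W : Type*} {G : SimpleGraph V} {H : SimpleGraph W} (ι : G ≃g H) :
    graphAut G ≃* graphAut H where
  toFun φ := (ι.symm.trans φ).trans ι
  invFun ψ := (ι.trans ψ).trans ι.symm
  left_inv φ := by ext1 x; simp
  right_inv ψ := by ext1 x; simp
  map_mul' φ ψ := by
    ext1 x
    change ι (φ (ψ (ι.symm x))) = ι (φ (ι.symm (ι (ψ (ι.symm x)))))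
    rw [ι.symm_apply_apply]

theorem theorem3p12 (n k : ℕ) (hn : 4 ≤ n) (hk : 1 ≤ k) (hkn : 2 * k < n) :
    (n ≠ 2 * k + 1 →
      Nonempty (graphAut (layerGraph n k).lineGraph ≃* Equiv.Perm (Fin n))) ∧
    (n = 2 * k + 1 →
      Nonempty (graphAut (layerGraph n k).lineGraph ≃*
        Equiv.Perm (Fin n) × Multiplicative (ZMod 2))) := by
  refine ⟨fun h => ⟨?_⟩, fun h => ⟨?_⟩⟩
  · exact ((MulEquiv.ofBijective _ (LayerFlag.permHom_bijective hk
      (by rw [Fintype.card_fin]; omega))).trans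
        (graphAutCongr (LayerFlag.graphIsoLineGraph n k))).symm
  · exact ((MulEquiv.ofBijective _ (LayerFlag.permComplHom_bijective hk
      ((Fintype.card_fin n).trans h))).trans
        (graphAutCongr (LayerFlag.graphIsoLineGraph n k))).symm
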